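/- **Proposition 3.1 (pdf of the mixture tempered stable subordinator).** Let $c_1,c_2\ge 0$ with $c_1+c_2=1$, let $\alpha_1,\alpha_2\in(0,1)$ and $\lambda_1,\lambda_2\ge 0$. Let $(S(t))_{t\ge 0}$ be a real-valued Lévy process such that, for all $t\ge0$ and $s>0$, $$\mathbb E\big[e^{-sS(t)}\big]=e^{-t\left(c_1((s+\lambda_1)^{\alpha_1}-\lambda_1^{\alpha_1})+c_2((s+\lambda_2)^{\alpha_2}-\lambda_2^{\alpha_2})\right)} .$$ Then for every $t>0$ the law of $S(t)$ is concentrated on $(0,\infty)$ and has there a nonnegative continuous density $g(x,t)$ with respect to Lebesgue measure, which for every $x>0$ is given by the following absolutely convergent integrals. (a) If $\lambda_1<\lambda_2$, then $$\begin{aligned} g(x,t)=\;&\frac1\pi\int_0^\infty e^{-x\lambda_2}e^{-wx}e^{t(c_1\lambda_1^{\alpha_1}+c_2\lambda_2^{\alpha_2})}\,e^{-t\left(c_1(\lambda_2-\lambda_1+w)^{\alpha_1}\cos(\pi\alpha_1)+c_2w^{\alpha_2}\cos(\pi\alpha_2)\right)}\\ &\qquad\times\sin\!\Big(t\big(c_1(\lambda_2-\lambda_1+w)^{\alpha_1}\sin(\pi\alpha_1)+c_2w^{\alpha_2}\sin(\pi\alpha_2)\big)\Big)\,dw\\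 &+\frac1\pi\int_0^{\lambda_2-\lambda_1}e^{-x\lambda_1}e^{-wx}e^{t(c_1\lambda_1^{\alpha_1}+c_2\lambda_2^{\alpha_2})}\,e^{-t\left(c_1w^{\alpha_1}\cos(\pi\alpha_1)+c_2(\lambda_2-\lambda_1-w)^{\alpha_2}\right)}\sin\!\big(t\,c_1w^{\alpha_1}\sin(\pi\alpha_1)\big)\,dw, \end{aligned}$$ where, for $0\le w<\lambda_2-\lambda_1$, $$(\lambda_2-\lambda_1+w)^{\alpha_1}=(\lambda_2-\lambda_1)^{\alpha_1}\sum_{k=0}^\infty\binom{\alpha_1}{k}\frac{w^k}{(\lambda_1-\lambda_2)^k}\cos(\pi k),\qquad (\lambda_2-\lambda_1-w)^{\alpha_2}=(\lambda_2-\lambda_1)^{\alpha_2}\sum_{k=0}^\infty\binom{\alpha_2}{k}\frac{w^k}{(\lambda_2-\lambda_1)^k}\cos(\pi k).$$ (b) If $\lambda_2<\lambda_1$, the same statements hold with the indices $1$ and $2$ exchanged throughout. (c) If $\lambda_1=\lambda_2=\lambda$, then $$g(x,t)=\frac1\pi\int_0^\infty e^{-x\lambda}e^{-wx}e^{t(c_1\lambda^{\alpha_1}+c_2\lambda^{\alpha_2})}\,e^{-t\left(c_1w^{\alpha_1}\cos(\pi\alpha_1)+c_2w^{\alpha_2}\cos(\pi\alpha_2)\right)}\sin\!\Big(t\big(c_1w^{\alpha_1}\sin(\pi\alpha_1)+c_2w^{\alpha_2}\sin(\pi\alpha_2)\big)\Big)\,dw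 .$$ -/

import Mathlib

open MeasureTheory ProbabilityTheory Filter Topology Set
open scoped NNReal ENNReal

/-- A real-valued Lévy process on the probability space `(Ω, P)`: it starts at `0` almost surely,
has independent and stationary increments, and is continuous in probability. -/
structure IsLevyProcess {Ω : Type*} [MeasurableSpace Ω] (P : Measure Ω) (S : ℝ≥0 → Ω → ℝ) :
    Prop where
  measurable : ∀ t, Measurable (S t)
  start_zero : ∀ᵐ ω ∂P, S 0 ω = 0
  indep_increments : HasIndepIncrements S P
  stationary_increments :
    ∀ s t : ℝ≥0, IdentDistrib (fun ω => S (s + t) ω - S s ω) (S t) P P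
  stochastic_continuity : ∀ t : ℝ≥0, TendstoInMeasure P S (𝓝 t) (S t)

/-- The Laplace exponent
`c₁((s + l₁)^α₁ - l₁^α₁) + c₂((s + l₂)^α₂ - l₂^α₂)`. -/
noncomputable def mtssExponent (c₁ c₂ α₁ α₂ l₁ l₂ s : ℝ) : ℝ :=
  c₁ * ((s + l₁) ^ α₁ - l₁ ^ α₁) + c₂ * ((s + l₂) ^ α₂ - l₂ ^ α₂)

/-- `S` is a mixture tempered stable subordinator: a Lévy process with
`E[exp(-s S(t))] = exp(-t ψ(s))` for all `s > 0`, where `ψ` is `mtssExponent`. -/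
structure IsMTSS {Ω : Type*} [MeasurableSpace Ω] (P : Measure Ω)
    (c₁ c₂ α₁ α₂ l₁ l₂ : ℝ) (S : ℝ≥0 → Ω → ℝ) : Prop where
  levy : IsLevyProcess P S
  laplace : ∀ (t : ℝ≥0) (s : ℝ), 0 < s →
    ∫ ω, Real.exp (-s * S t ω) ∂P = Real.exp (-(t : ℝ) * mtssExponent c₁ c₂ α₁ α₂ l₁ l₂ s)

/-- Integrand over `0 < w < ∞` for `l₁ < l₂`: the contribution of the part of the cut
beyond both branch points, `s = -l₂ - w`. -/
noncomputable def mtssOuterIntegrand (c₁ c₂ α₁ α₂ l₁ l₂ x t w : ℝ) : ℝ :=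
  Real.exp (-x * l₂) * Real.exp (-w * x) * Real.exp (t * (c₁ * l₁ ^ α₁ + c₂ * l₂ ^ α₂))
    * Real.exp (-t * (c₁ * (l₂ - l₁ + w) ^ α₁ * Real.cos (Real.pi * α₁)
        + c₂ * w ^ α₂ * Real.cos (Real.pi * α₂)))
    * Real.sin (t * (c₁ * (l₂ - l₁ + w) ^ α₁ * Real.sin (Real.pi * α₁)
        + c₂ * w ^ α₂ * Real.sin (Real.pi * α₂)))

/-- Integrand over `0 < w < l₂ - l₁` for `l₁ < l₂`: the contribution of the part of the cut
between the two branch points, `s = -l₁ - w`. -/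
noncomputable def mtssInnerIntegrand (c₁ c₂ α₁ α₂ l₁ l₂ x t w : ℝ) : ℝ :=
  Real.exp (-x * l₁) * Real.exp (-w * x) * Real.exp (t * (c₁ * l₁ ^ α₁ + c₂ * l₂ ^ α₂))
    * Real.exp (-t * (c₁ * w ^ α₁ * Real.cos (Real.pi * α₁) + c₂ * (l₂ - l₁ - w) ^ α₂))
    * Real.sin (t * (c₁ * w ^ α₁ * Real.sin (Real.pi * α₁)))

/-- The integral representation for `l₁ < l₂`. -/
noncomputable def mtssDensityOfLT (c₁ c₂ α₁ α₂ l₁ l₂ x t : ℝ) : ℝ :=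
  1 / Real.pi * (∫ w in Ioi (0 : ℝ), mtssOuterIntegrand c₁ c₂ α₁ α₂ l₁ l₂ x t w)
    + 1 / Real.pi * (∫ w in Ioo (0 : ℝ) (l₂ - l₁), mtssInnerIntegrand c₁ c₂ α₁ α₂ l₁ l₂ x t w)

/-- Integrand over `0 < w < ∞` when both tempering parameters equal `l`. -/
noncomputable def mtssEqIntegrand (c₁ c₂ α₁ α₂ l x t w : ℝ) : ℝ :=
  Real.exp (-x * l) * Real.exp (-w * x) * Real.exp (t * (c₁ * l ^ α₁ + c₂ * l ^ α₂))
    * Real.exp (-t * (c₁ * w ^ α₁ * Real.cos (Real.pi * α₁)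
        + c₂ * w ^ α₂ * Real.cos (Real.pi * α₂)))
    * Real.sin (t * (c₁ * w ^ α₁ * Real.sin (Real.pi * α₁)
        + c₂ * w ^ α₂ * Real.sin (Real.pi * α₂)))

/-- The integral representation when both tempering parameters equal `l`. -/
noncomputable def mtssDensityOfEq (c₁ c₂ α₁ α₂ l x t : ℝ) : ℝ :=
  1 / Real.pi * ∫ w in Ioi (0 : ℝ), mtssEqIntegrand c₁ c₂ α₁ α₂ l x t w

/-- The law of `X` lives on `(0, ∞)` and `g` is its probability density there, in the version that
is nonnegative and continuous at every point of `(0, ∞)` (hence unique). -/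
structure HasContinuousDensityOnPos {Ω : Type*} [MeasurableSpace Ω] (P : Measure Ω)
    (X : Ω → ℝ) (g : ℝ → ℝ) : Prop where
  nonneg : ∀ x, 0 < x → 0 ≤ g x
  continuousOn : ContinuousOn g (Ioi 0)
  map_eq : P.map X = (volume.restrict (Ioi (0 : ℝ))).withDensity (fun x => ENNReal.ofReal (g x))

/-!
The law of `S t` has the Laplace transform `F(z) = exp (-t ψ(z))` for `z > 0`. The Laplace transform
is bounded by one, so `S t` is almost surely nonnegative (`ae_nonneg_of_mgf_le_one`); its transform
is then analytic in the right half-plane, equals `F` there by the identity theorem, and by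
continuity the characteristic function is `F` on the imaginary axis
(`charFun_map_eq_mtssTransform`). Since `Re (z ^ α)` is at least `cos (π α / 2) |z| ^ α` for
`Re z ≥ 0`, this function is integrable, and Fourier inversion
(`eq_withDensity_of_integrable_charFun`) gives the continuous density
`(1 / π) Re ∫ exp (i u x) F(i u) du` over `u > 0`.

With principal powers `F` is analytic in the upper half-plane and continuous up to its boundary,
including the upper side of the cut `(-∞, 0]`. For `x > 0` the function `exp (x z) F(z)` decays
exponentially in the distance to the right half-plane, because `ψ` grows sublinearly, and tends to
zero along vertical lines, because `Re (z ^ α)` tends to infinity near the imaginary direction. So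
the contour can be turned from the positive imaginary axis onto the negative real axis
(`integral_imaginary_axis_eq_neg_real_axis`), and the density becomes
`-(1 / π) Im ∫ exp (-v x) F(-v) dv` over `v > 0` (`hasContinuousDensityOnPos_cut_integral`).

The branch points are `-l₁` and `-l₂`. With `l₁ ≤ l₂`, the boundary value `F(-v)` is real for
`v ≤ l₁`, one of the two powers is non-real for `l₁ < v < l₂`, and both are for `v > l₂`: this
splits the cut integral into the inner and the outer integral
(`mtssDensityOfLT_eq_cut_integral`). For `l₁ = l₂` the inner one is empty, and the case `l₂ < l₁`
follows by exchanging the two components.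
-/

/-! ### Principal powers on the closed upper half-plane -/

theorem continuousOn_cpow_upperHalfPlane {α : ℝ} (hα : 0 < α) :
    ContinuousOn (fun z : ℂ => z ^ (α : ℂ)) {z | 0 ≤ z.im} := by
  intro z hz
  by_cases h : 0 ≤ z.re ∨ z.im ≠ 0
  · exact (Complex.continuousAt_cpow_const_of_re_pos h (by simpa using hα)).continuousWithinAt
  · push Not at h
    have hne : z ≠ 0 := fun h0 => by simp [h0] at h
    have hlog := Complex.continuousWithinAt_log_of_re_neg_of_im_zero h.1 h.2
    refine ((hlog.mul continuousWithinAt_const).cexp).congr_of_eventuallyEq ?_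
      (Complex.cpow_def_of_ne_zero hne _)
    filter_upwards [mem_nhdsWithin_of_mem_nhds (isOpen_ne.mem_nhds hne)] with w hw
    exact Complex.cpow_def_of_ne_zero hw _

theorem cos_mul_norm_rpow_le_re_cpow {α : ℝ} (hα : α ∈ Ioo (0 : ℝ) 1) {w : ℂ} (hw : 0 ≤ w.re) :
    Real.cos (Real.pi / 2 * α) * ‖w‖ ^ α ≤ (w ^ (α : ℂ)).re := by
  rw [Complex.cpow_ofReal_re, mul_comm]
  refine mul_le_mul_of_nonneg_left ?_ (by positivity)
  rw [← Real.cos_abs (w.arg * α), abs_mul, abs_of_pos hα.1]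
  have h := Complex.abs_arg_le_pi_div_two_iff.2 hw
  apply Real.cos_le_cos_of_nonneg_of_le_pi
  · have := hα.1; positivity
  · nlinarith [Real.pi_pos, hα.1, hα.2]
  · exact mul_le_mul_of_nonneg_right h hα.1.le

theorem cos_pi_div_two_mul_pos {α : ℝ} (hα : α ∈ Ioo (0 : ℝ) 1) :
    0 < Real.cos (Real.pi / 2 * α) := by
  apply Real.cos_pos_of_mem_Ioo
  constructor <;> nlinarith [Real.pi_pos, hα.1, hα.2]

/-- By continuity at `I` and homogeneity, the real part of `w ^ α` is still comparable to
`(Im w) ^ α` in a sector slightly larger than the quarter-plane, around the imaginary axis. -/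
theorem exists_sector_le_re_cpow {α : ℝ} (hα : α ∈ Ioo (0 : ℝ) 1) :
    ∃ δ > 0, ∃ m > 0, ∀ w : ℂ, 0 < w.im → |w.re| ≤ δ * w.im →
      m * w.im ^ α ≤ (w ^ (α : ℂ)).re := by
  have hc := cos_pi_div_two_mul_pos hα
  set m := Real.cos (Real.pi / 2 * α) / 2 with hm
  have hcont : ContinuousAt (fun w : ℂ => (w ^ (α : ℂ)).re) Complex.I :=
    Complex.continuous_re.continuousAt.comp
      (Complex.continuousAt_cpow_const_of_re_pos (Or.inl (by simp)) (by simpa using hα.1))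
  have hI : m < (Complex.I ^ (α : ℂ)).re := by
    have := cos_mul_norm_rpow_le_re_cpow hα (w := Complex.I) (by simp)
    simp only [Complex.norm_I, Real.one_rpow, mul_one] at this
    linarith
  obtain ⟨ε, hε, hball⟩ := Metric.eventually_nhds_iff.1 (hcont.eventually (lt_mem_nhds hI))
  refine ⟨ε / 2, by positivity, m, by positivity, fun w hw hre => ?_⟩
  set u : ℂ := ⟨w.re / w.im, 1⟩ with hu
  have hwu : w = (w.im : ℂ) * u := by
    apply Complex.ext
    · simp [hu]; field_simp
    · simp [hu]
  have hdist : dist u Complex.I < ε := by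
    have h1 : u - Complex.I = ((w.re / w.im : ℝ) : ℂ) := by
      apply Complex.ext <;> simp [hu]
    rw [dist_eq_norm, h1, Complex.norm_real, Real.norm_eq_abs, abs_div, abs_of_pos hw,
      div_lt_iff₀ hw]
    nlinarith
  have hpow : (w ^ (α : ℂ)).re = w.im ^ α * (u ^ (α : ℂ)).re := by
    conv_lhs => rw [hwu]
    rw [Complex.cpow_ofReal_re, Complex.cpow_ofReal_re, Complex.arg_real_mul _ hw, norm_mul,
      Complex.norm_real, Real.norm_of_nonneg hw.le, Real.mul_rpow hw.le (norm_nonneg _)]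
    ring
  rw [hpow, mul_comm]
  exact mul_le_mul_of_nonneg_left (hball hdist).le (by positivity)

/-- On the upper half-plane the real part of `w ^ α` is bounded below in terms of the distance
to the right half-plane only: close to the imaginary axis it is positive, and elsewhere `‖w‖` is
comparable to `|Re w|`. -/
theorem exists_neg_rpow_le_re_cpow {α : ℝ} (hα : α ∈ Ioo (0 : ℝ) 1) :
    ∃ K ≥ 0, ∀ w : ℂ, 0 ≤ w.im → ∀ v : ℝ, 0 ≤ v → -v ≤ w.re →
      -(K * v ^ α) ≤ (w ^ (α : ℂ)).re := by
  obtain ⟨δ, hδ, m, hm, hsec⟩ := exists_sector_le_re_cpow hα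
  refine ⟨(1 + 1 / δ) ^ α, by positivity, fun w him v hv hwv => ?_⟩
  have hneg : -((1 + 1 / δ) ^ α * v ^ α) ≤ 0 := neg_nonpos.2 (by positivity)
  rcases le_or_gt 0 w.re with hre | hre
  · refine hneg.trans (le_trans ?_ (cos_mul_norm_rpow_le_re_cpow hα hre))
    have := cos_pi_div_two_mul_pos hα
    positivity
  · by_cases hs : 0 < w.im ∧ |w.re| ≤ δ * w.im
    · exact hneg.trans (le_trans (by have := hs.1; positivity) (hsec w hs.1 hs.2))
    · -- outside the sector `w.im ≤ |w.re| / δ`, so the trivial bound by the norm suffices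
      have him' : w.im ≤ 1 / δ * v := by
        rcases him.eq_or_lt with h | h
        · rw [← h]; positivity
        · have h2 : δ * w.im < |w.re| := not_le.1 fun h3 => hs ⟨h, h3⟩
          rw [abs_of_neg hre] at h2
          rw [one_div, ← div_eq_inv_mul, le_div_iff₀ hδ]
          linarith
      have hnorm : ‖w‖ ≤ (1 + 1 / δ) * v := by
        refine (Complex.norm_le_abs_re_add_abs_im w).trans ?_
        rw [abs_of_neg hre, abs_of_nonneg him]
        linarith
      rw [← Real.mul_rpow (by positivity) hv]
      have h1 : ‖w ^ (α : ℂ)‖ ≤ ((1 + 1 / δ) * v) ^ α := by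
        rw [Complex.norm_cpow_real]
        exact Real.rpow_le_rpow (norm_nonneg _) hnorm hα.1.le
      have h2 := (abs_le.1 (Complex.abs_re_le_norm (w ^ (α : ℂ)))).1
      linarith

/-- The sublinear power `v ^ α` is absorbed by an arbitrarily small linear term. -/
theorem exists_mul_rpow_le_linear {α : ℝ} (hα : α < 1) (hα0 : 0 < α) (K : ℝ) (hK : 0 ≤ K)
    {a : ℝ} (ha : 0 < a) :
    ∃ B, ∀ v : ℝ, 0 ≤ v → K * v ^ α ≤ a * v + B := by
  have ht : Tendsto (fun v : ℝ => K * v ^ (-(1 - α))) atTop (𝓝 (K * 0)) :=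
    (tendsto_rpow_neg_atTop (by linarith)).const_mul K
  rw [mul_zero] at ht
  obtain ⟨N, hN⟩ := eventually_atTop.1 ((ht.eventually (gt_mem_nhds ha)).and
    (eventually_ge_atTop 1))
  have hN1 := (hN N le_rfl).2
  refine ⟨K * N ^ α, fun v hv => ?_⟩
  rcases le_or_gt N v with h | h
  · have hv0 : 0 < v := by linarith
    have h1 : K * v ^ α = K * v ^ (-(1 - α)) * v := by
      rw [mul_assoc, ← Real.rpow_add_one hv0.ne']
      ring_nf
    have h2 : K * v ^ (-(1 - α)) * v ≤ a * v :=
      mul_le_mul_of_nonneg_right (hN v h).1.le hv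
    have h3 : 0 ≤ K * N ^ α := by positivity
    linarith
  · have h1 : K * v ^ α ≤ K * N ^ α :=
      mul_le_mul_of_nonneg_left (Real.rpow_le_rpow hv h.le hα0.le) hK
    have : 0 ≤ a * v := by positivity
    linarith

/-! ### Turning the positive imaginary axis onto the negative real axis -/

theorem integrableOn_neg_ray_of_bound {G : ℂ → ℂ}
    (hcont : ContinuousOn G {z | 0 ≤ z.im}) {M b : ℝ} (hb : 0 < b)
    (hbound : ∀ v y : ℝ, 0 ≤ v → 0 ≤ y → ‖G (-v + y * Complex.I)‖ ≤ M * Real.exp (-b * v)) :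
    IntegrableOn (fun v : ℝ => G (-v)) (Ioi 0) := by
  have hcontv : Continuous fun v : ℝ => G (-v) := by
    rw [← continuousOn_univ]
    exact hcont.comp (by fun_prop) fun v _ => by simp
  refine Integrable.mono' ((exp_neg_integrableOn_Ioi 0 hb).const_mul M)
    hcontv.aestronglyMeasurable ?_
  filter_upwards [ae_restrict_mem measurableSet_Ioi] with v hv
  simpa using hbound v 0 (le_of_lt hv) le_rfl

/-- Rotation of a contour by a quarter turn: Cauchy's theorem on the squares `[-n, 0] × [0, n]`,
whose left and top sides contribute nothing in the limit. -/
theorem integral_imaginary_axis_eq_neg_real_axis {G : ℂ → ℂ}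
    (hcont : ContinuousOn G {z | 0 ≤ z.im}) (hdiff : DifferentiableOn ℂ G {z | 0 < z.im})
    {M b : ℝ} (hb : 0 < b)
    (hbound : ∀ v y : ℝ, 0 ≤ v → 0 ≤ y → ‖G (-v + y * Complex.I)‖ ≤ M * Real.exp (-b * v))
    (hlim : ∀ v : ℝ, 0 < v → Tendsto (fun y : ℝ => G (-v + y * Complex.I)) atTop (𝓝 0))
    (hint : IntegrableOn (fun u : ℝ => G (u * Complex.I)) (Ioi 0)) :
    Complex.I * ∫ u in Ioi (0 : ℝ), G (u * Complex.I) = - ∫ v in Ioi (0 : ℝ), G (-v) := by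
  have hexp : IntegrableOn (fun v : ℝ => M * Real.exp (-b * v)) (Ioi 0) :=
    (exp_neg_integrableOn_Ioi 0 hb).const_mul M
  have hneg := integrableOn_neg_ray_of_bound hcont hb hbound
  have hn : Tendsto (fun n : ℕ => (n : ℝ)) atTop atTop := tendsto_natCast_atTop_atTop
  have hrect : ∀ n : ℕ,
      (∫ v in (0 : ℝ)..n, G (-v)) - (∫ v in (0 : ℝ)..n, G (-v + (n : ℝ) * Complex.I))
        + Complex.I * (∫ u in (0 : ℝ)..n, G (u * Complex.I))
        - Complex.I * (∫ y in (0 : ℝ)..n, G (-(n : ℝ) + y * Complex.I)) = 0 := by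
    intro n
    have hn0 : (0 : ℝ) ≤ n := n.cast_nonneg
    have h := Complex.integral_boundary_rect_eq_zero_of_continuousOn_of_differentiableOn G
      (⟨-n, 0⟩ : ℂ) (⟨0, n⟩ : ℂ) (hcont.mono ?_) (hdiff.mono ?_)
    · have e1 : ∀ y : ℝ, (∫ x in (-(n : ℝ))..0, G (x + y * Complex.I))
          = ∫ v in (0 : ℝ)..n, G (-v + y * Complex.I) := by
        intro y
        have := intervalIntegral.integral_comp_neg (a := 0) (b := (n : ℝ))
          (fun x : ℝ => G (x + y * Complex.I))
        simp only [neg_zero] at this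
        rw [← this]
        simp
      simp only [e1, smul_eq_mul] at h
      simpa using h
    · intro z hz
      rw [Complex.mem_reProdIm] at hz
      have := hz.2
      rw [uIcc_of_le hn0] at this
      exact this.1
    · intro z hz
      rw [Complex.mem_reProdIm] at hz
      have := hz.2
      simp only [min_eq_left hn0] at this
      exact this.1
  have hbot := intervalIntegral_tendsto_integral_Ioi 0 hneg hn
  have hright := intervalIntegral_tendsto_integral_Ioi 0 hint hn
  have hM : 0 ≤ M := by
    have := (norm_nonneg _).trans (hbound 0 0 le_rfl le_rfl)
    simpa using this
  have htop : Tendsto (fun n : ℕ => ∫ v in (0 : ℝ)..n, G (-v + (n : ℝ) * Complex.I))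
      atTop (𝓝 0) := by
    have hd : Tendsto (fun n : ℕ => ∫ v in Ioi (0 : ℝ),
        (Ioc (0 : ℝ) n).indicator (fun v : ℝ => G (-v + (n : ℝ) * Complex.I)) v)
        atTop (𝓝 (∫ _ in Ioi (0 : ℝ), (0 : ℂ))) := by
      refine tendsto_integral_of_dominated_convergence _ (fun n => ?_) hexp (fun n => ?_) ?_
      · refine (Continuous.aestronglyMeasurable ?_).indicator measurableSet_Ioc
        rw [← continuousOn_univ]
        exact hcont.comp (by fun_prop) fun v _ => by simp
      · filter_upwards [ae_restrict_mem measurableSet_Ioi] with v hv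
        refine (norm_indicator_le_norm_self _ _).trans ?_
        exact hbound v n (le_of_lt hv) n.cast_nonneg
      · filter_upwards [ae_restrict_mem measurableSet_Ioi] with v hv
        refine squeeze_zero_norm (fun n => norm_indicator_le_norm_self _ _) ?_
        simpa using ((hlim v hv).comp hn).norm
    rw [integral_zero] at hd
    refine hd.congr fun n => ?_
    rw [integral_indicator measurableSet_Ioc, Measure.restrict_restrict measurableSet_Ioc,
      inter_eq_left.2 Ioc_subset_Ioi_self, intervalIntegral.integral_of_le n.cast_nonneg]
  have hleft : Tendsto (fun n : ℕ => ∫ y in (0 : ℝ)..n, G (-(n : ℝ) + y * Complex.I))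
      atTop (𝓝 0) := by
    have hz : Tendsto (fun n : ℕ => M * ((n : ℝ) ^ (1 : ℝ) * Real.exp (-b * n)))
        atTop (𝓝 (M * 0)) :=
      ((tendsto_rpow_mul_exp_neg_mul_atTop_nhds_zero 1 b hb).comp hn).const_mul M
    rw [mul_zero] at hz
    refine squeeze_zero_norm (fun n => ?_) hz
    have h := intervalIntegral.norm_integral_le_of_norm_le_const (a := 0) (b := (n : ℝ))
      (f := fun y : ℝ => G (-(n : ℝ) + y * Complex.I)) (C := M * Real.exp (-b * n)) ?_
    · rw [sub_zero, abs_of_nonneg n.cast_nonneg] at h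
      rw [Real.rpow_one]
      linarith
    · intro y hy
      rw [uIoc_of_le n.cast_nonneg] at hy
      have := hbound n y n.cast_nonneg hy.1.le
      simpa using this
  have hall := ((hbot.sub htop).add (hright.const_mul Complex.I)).sub (hleft.const_mul Complex.I)
  have := tendsto_nhds_unique (hall.congr hrect) tendsto_const_nhds
  rw [sub_zero, mul_zero, sub_zero] at this
  linear_combination this

/-! ### Densities from integrable characteristic functions -/

/-- If a finite measure acts on test functions as a bounded continuous function `f`, then `f` is
nonnegative and is a density of the measure. Both sides are compared through their densities with
respect to `μ + volume`, so that the fundamental lemma of the calculus of variations applies. -/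
theorem nonneg_and_eq_withDensity_of_integral_contDiff {μ : Measure ℝ} [IsFiniteMeasure μ]
    {f : ℝ → ℝ} (hf : Continuous f) {C : ℝ} (hC : ∀ x, |f x| ≤ C)
    (h : ∀ g : ℝ → ℝ, ContDiff ℝ ((⊤ : ℕ∞) : WithTop ℕ∞) g → HasCompactSupport g →
      ∫ x, g x ∂μ = ∫ x, g x * f x) :
    (∀ x, 0 ≤ f x) ∧ μ = volume.withDensity (fun x => ENNReal.ofReal (f x)) := by
  set ρ : Measure ℝ := μ + volume with hρ
  have hμρ : μ ≪ ρ := Measure.AbsolutelyContinuous.rfl.add_right _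
  have hvρ : (volume : Measure ℝ) ≪ ρ := by
    rw [hρ, add_comm]; exact Measure.AbsolutelyContinuous.rfl.add_right _
  have hvle : (volume : Measure ℝ) ≤ ρ := Measure.le_add_left le_rfl
  set p : ℝ → ℝ≥0∞ := μ.rnDeriv ρ with hp
  set q : ℝ → ℝ≥0∞ := (volume : Measure ℝ).rnDeriv ρ with hq
  have hpm : Measurable p := Measure.measurable_rnDeriv _ _
  have hqm : Measurable q := Measure.measurable_rnDeriv _ _
  have hq1 : ∀ᵐ x ∂ρ, q x ≤ 1 := Measure.rnDeriv_le_one_of_le hvle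
  have hpt : ∀ᵐ x ∂ρ, p x < ∞ := Measure.rnDeriv_lt_top _ _
  have : IsLocallyFiniteMeasure ρ := ⟨fun x => by
    obtain ⟨s, hs, hfin⟩ := (volume : Measure ℝ).finiteAt_nhds x
    exact ⟨s, hs, by
      rw [hρ, Measure.add_apply]; exact ENNReal.add_lt_top.2 ⟨measure_lt_top μ s, hfin⟩⟩⟩
  have hloc1 : LocallyIntegrable (fun x => (p x).toReal) ρ :=
    (Measure.integrable_toReal_rnDeriv (μ := μ) (ν := ρ)).locallyIntegrable
  have hloc2 : LocallyIntegrable (fun x => (q x).toReal * f x) ρ := by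
    refine (locallyIntegrable_const C).mono
      (hqm.ennreal_toReal.mul hf.measurable).aestronglyMeasurable ?_
    filter_upwards [hq1] with x hx
    have h1 : (q x).toReal ≤ 1 := ENNReal.toReal_mono ENNReal.one_ne_top hx
    rw [norm_mul, Real.norm_eq_abs, Real.norm_eq_abs, Real.norm_eq_abs,
      abs_of_nonneg ENNReal.toReal_nonneg]
    calc (q x).toReal * |f x| ≤ 1 * |f x| := by gcongr
      _ ≤ |C| := by rw [one_mul]; exact (hC x).trans (le_abs_self C)
  have hae : ∀ᵐ x ∂ρ, (p x).toReal = (q x).toReal * f x := by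
    refine ae_eq_of_integral_contDiff_smul_eq hloc1 hloc2 fun g hg hgc => ?_
    have e1 : ∫ x, g x • (p x).toReal ∂ρ = ∫ x, g x ∂μ := by
      rw [← integral_rnDeriv_smul hμρ]
      simp only [smul_eq_mul, mul_comm, hp]
    have e2 : ∫ x, g x • ((q x).toReal * f x) ∂ρ = ∫ x, g x * f x := by
      rw [← integral_rnDeriv_smul hvρ]
      congr 1 with x
      simp only [smul_eq_mul, hq]
      ring
    rw [e1, e2, h g hg hgc]
  have hnn : ∀ x, 0 ≤ f x := by
    have hae' : ∀ᵐ x, 0 ≤ f x := by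
      filter_upwards [hvρ.ae_le hae, Measure.rnDeriv_pos hvρ, hvρ.ae_le hq1] with x h1 h2 h3
      have hqpos : 0 < (q x).toReal :=
        ENNReal.toReal_pos h2.ne' (h3.trans_lt ENNReal.one_lt_top).ne
      have : 0 ≤ (q x).toReal * f x := h1 ▸ ENNReal.toReal_nonneg
      exact nonneg_of_mul_nonneg_right this hqpos
    have heq : (fun x => max (f x) 0) = f := by
      refine Measure.eq_of_ae_eq (μ := volume) ?_ (hf.max continuous_const) hf
      filter_upwards [hae'] with x hx using max_eq_left hx
    intro x
    rw [← congrFun heq x]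
    exact le_max_right _ _
  refine ⟨hnn, ?_⟩
  conv_lhs => rw [← Measure.withDensity_rnDeriv_eq μ ρ hμρ]
  conv_rhs => rw [← Measure.withDensity_rnDeriv_eq volume ρ hvρ]
  rw [← withDensity_mul _ hqm hf.measurable.ennreal_ofReal]
  refine withDensity_congr_ae ?_
  filter_upwards [hae, hpt, hq1] with x h1 h2 h3
  change p x = q x * ENNReal.ofReal (f x)
  rw [← ENNReal.ofReal_toReal h2.ne, h1, ENNReal.ofReal_mul ENNReal.toReal_nonneg,
    ENNReal.ofReal_toReal (h3.trans_lt ENNReal.one_lt_top).ne]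

open FourierTransform in
/-- Parseval's identity for a finite measure with integrable characteristic function. -/
theorem integral_eq_integral_mul_fourier_charFun {μ : Measure ℝ} [IsFiniteMeasure μ]
    (hμ : Integrable (charFun μ)) (h : SchwartzMap ℝ ℂ) :
    ∫ x, h x ∂μ = ∫ x, 𝓕 (fun w : ℝ => charFun μ (2 * Real.pi * w)) x * h x := by
  have hχ : Integrable fun w : ℝ => charFun μ (2 * Real.pi * w) :=
    hμ.comp_mul_left' (by positivity)
  have hL : Continuous fun p : ℝ × ℝ => (innerₗ ℝ p.1) p.2 := continuous_inner
  have hflip : (innerₗ ℝ : ℝ →ₗ[ℝ] ℝ →ₗ[ℝ] ℝ).flip = innerₗ ℝ := flip_innerₗ ℝ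
  have hinv : 𝓕 (fun w => 𝓕⁻ h w) = fun x => h x := by
    have := congrArg (fun k : SchwartzMap ℝ ℂ => (k : ℝ → ℂ)) 
      (FourierTransform.fourier_fourierInv_eq (F := SchwartzMap ℝ ℂ) h)
    exact this
  have h1 := VectorFourier.integral_fourierIntegral_smul_eq_flip (μ := μ) (ν := volume)
    (L := innerₗ ℝ) (e := Real.fourierChar) (f := fun _ : ℝ => (1 : ℂ)) (g := fun w => 𝓕⁻ h w)
    Real.continuous_fourierChar hL (integrable_const _) (𝓕⁻ h).integrable
  have h2 := VectorFourier.integral_fourierIntegral_smul_eq_flip (μ := volume) (ν := volume)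
    (L := innerₗ ℝ) (e := Real.fourierChar) (f := fun w : ℝ => charFun μ (2 * Real.pi * w))
    (g := h) Real.continuous_fourierChar hL hχ h.integrable
  rw [hflip] at h1 h2
  have hφ : ∀ w : ℝ, VectorFourier.fourierIntegral Real.fourierChar μ (innerₗ ℝ)
      (fun _ : ℝ => (1 : ℂ)) w = charFun μ (2 * Real.pi * -w) := by
    intro w
    rw [charFun_eq_fourierIntegral']
    congr 1
    simp only [smul_eq_mul]
    field_simp
  have hR : ∀ x, VectorFourier.fourierIntegral Real.fourierChar volume (innerₗ ℝ)
      (fun w => 𝓕⁻ h w) x = h x := fun x => congrFun hinv x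
  simp only [hφ, hR, smul_eq_mul, one_mul] at h1
  rw [← h1]
  change ∫ x, VectorFourier.fourierIntegral Real.fourierChar volume (innerₗ ℝ)
      (fun w : ℝ => charFun μ (2 * Real.pi * w)) x • h x
      = ∫ w, charFun μ (2 * Real.pi * w) • 𝓕 (fun x => h x) w at h2
  simp only [smul_eq_mul] at h2
  refine Eq.trans ?_ h2.symm
  rw [← integral_neg_eq_self]
  congr 1 with w
  rw [neg_neg, SchwartzMap.fourierInv_coe, Real.fourierInv_eq_fourier_neg, neg_neg]

open FourierTransform in
/-- Fourier inversion for a finite measure with integrable characteristic function. -/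
theorem eq_withDensity_of_integrable_charFun {μ : Measure ℝ} [IsFiniteMeasure μ]
    (hμ : Integrable (charFun μ)) {f : ℝ → ℝ}
    (hf : ∀ x, f x = (𝓕 (fun w : ℝ => charFun μ (2 * Real.pi * w)) x).re) :
    Continuous f ∧ (∀ x, 0 ≤ f x) ∧ μ = volume.withDensity (fun x => ENNReal.ofReal (f x)) := by
  set χ : ℝ → ℂ := fun w : ℝ => charFun μ (2 * Real.pi * w) with hχdef
  have hχ : Integrable χ := hμ.comp_mul_left' (by positivity)
  have hcont : Continuous (𝓕 χ) := VectorFourier.fourierIntegral_continuous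
    Real.continuous_fourierChar continuous_inner hχ
  have hbd : ∀ x, ‖𝓕 χ x‖ ≤ ∫ w, ‖χ w‖ := fun x =>
    VectorFourier.norm_fourierIntegral_le_integral_norm _ _ _ _ _
  have hfe : f = fun x => (𝓕 χ x).re := funext hf
  have hfc : Continuous f := by rw [hfe]; exact Complex.continuous_re.comp hcont
  refine ⟨hfc, nonneg_and_eq_withDensity_of_integral_contDiff hfc
    (fun x => ((hf x) ▸ Complex.abs_re_le_norm _).trans (hbd x)) fun g hg hgc => ?_⟩
  have hgc' : HasCompactSupport (fun x => (g x : ℂ)) := hgc.comp_left Complex.ofReal_zero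
  have hg' : ContDiff ℝ ((⊤ : ℕ∞) : WithTop ℕ∞) (fun x => (g x : ℂ)) :=
    Complex.ofRealCLM.contDiff.comp hg
  have key := integral_eq_integral_mul_fourier_charFun hμ (hgc'.toSchwartzMap hg')
  have hcoe : ∀ x, (hgc'.toSchwartzMap hg') x = (g x : ℂ) := fun x => rfl
  simp only [hcoe] at key
  rw [integral_complex_ofReal] at key
  have hint : Integrable fun x => 𝓕 χ x * (g x : ℂ) := by
    refine (Complex.continuous_ofReal.comp hg.continuous).integrable_of_hasCompactSupport hgc'
      |>.bdd_mul hcont.aestronglyMeasurable (Eventually.of_forall hbd)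
  have := congrArg Complex.re key
  rw [Complex.ofReal_re] at this
  rw [this]
  refine (Complex.reCLM.integral_comp_comm hint).symm.trans ?_
  congr 1 with x
  simp [hf x, mul_comm]

/-! ### The Laplace transform of the subordinator in the complex plane -/

/-- The function `exp (-t ψ(z))` of a complex variable, where `ψ` is the Laplace exponent
`mtssExponent` written with principal powers. On the cut `(-∞, 0]` the principal power is the
boundary value from the upper half-plane, so this function is continuous on `{z | 0 ≤ z.im}`. -/
noncomputable def mtssTransform (c₁ c₂ α₁ α₂ l₁ l₂ t : ℝ) (z : ℂ) : ℂ :=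
  Complex.exp (-t * (c₁ * ((z + l₁) ^ (α₁ : ℂ) - (l₁ ^ α₁ : ℝ))
    + c₂ * ((z + l₂) ^ (α₂ : ℂ) - (l₂ ^ α₂ : ℝ))))

section Transform

variable {c₁ c₂ α₁ α₂ l₁ l₂ t : ℝ}

theorem norm_mtssTransform (z : ℂ) :
    ‖mtssTransform c₁ c₂ α₁ α₂ l₁ l₂ t z‖
      = Real.exp (t * (c₁ * l₁ ^ α₁ + c₂ * l₂ ^ α₂))
        * Real.exp (-t * (c₁ * ((z + l₁) ^ (α₁ : ℂ)).re + c₂ * ((z + l₂) ^ (α₂ : ℂ)).re)) := by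
  rw [mtssTransform, Complex.norm_exp, ← Real.exp_add]
  congr 1
  rw [← Complex.ofReal_neg, Complex.re_ofReal_mul, Complex.add_re, Complex.re_ofReal_mul,
    Complex.re_ofReal_mul, Complex.sub_re, Complex.sub_re, Complex.ofReal_re, Complex.ofReal_re]
  ring

theorem mtssTransform_ofReal (hl₁ : 0 ≤ l₁) (hl₂ : 0 ≤ l₂) {s : ℝ} (hs : 0 ≤ s) :
    mtssTransform c₁ c₂ α₁ α₂ l₁ l₂ t s
      = (Real.exp (-t * mtssExponent c₁ c₂ α₁ α₂ l₁ l₂ s) : ℝ) := by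
  rw [mtssTransform, mtssExponent, ← Complex.ofReal_add, ← Complex.ofReal_add,
    ← Complex.ofReal_cpow (by positivity), ← Complex.ofReal_cpow (by positivity)]
  push_cast
  rfl

theorem continuousOn_mtssTransform (hα₁ : 0 < α₁) (hα₂ : 0 < α₂) :
    ContinuousOn (mtssTransform c₁ c₂ α₁ α₂ l₁ l₂ t) {z | 0 ≤ z.im} := by
  have h : ∀ (l : ℝ) {α : ℝ}, 0 < α →
      ContinuousOn (fun z : ℂ => (z + l) ^ (α : ℂ)) {z | 0 ≤ z.im} := fun l α hα =>
    (continuousOn_cpow_upperHalfPlane hα).comp (by fun_prop) fun z hz => by simpa using hz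
  have h1 := h l₁ hα₁
  have h2 := h l₂ hα₂
  unfold mtssTransform
  fun_prop

theorem differentiableOn_mtssTransform (hl₁ : 0 ≤ l₁) (hl₂ : 0 ≤ l₂) :
    DifferentiableOn ℂ (mtssTransform c₁ c₂ α₁ α₂ l₁ l₂ t) {z | 0 < z.re ∨ z.im ≠ 0} := by
  have h : ∀ {l : ℝ} (α : ℝ), 0 ≤ l →
      DifferentiableOn ℂ (fun z : ℂ => (z + l) ^ (α : ℂ)) {z | 0 < z.re ∨ z.im ≠ 0} := by
    intro l α hl z hz
    refine (DifferentiableAt.cpow_const (by fun_prop) ?_).differentiableWithinAt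
    rw [Complex.mem_slitPlane_iff]
    rcases hz with hz | hz
    · left; simp only [Complex.add_re, Complex.ofReal_re]; linarith
    · right; simpa using hz
  have h1 := h α₁ hl₁
  have h2 := h α₂ hl₂
  unfold mtssTransform
  exact (((h1.sub_const _).const_mul _).add ((h2.sub_const _).const_mul _)).const_mul _ |>.cexp

/-- In the upper half-plane `exp (x z - t ψ(z))` decays exponentially in the distance to the right
half-plane: there the exponent grows at most like a power with exponent less than one. -/
theorem exists_norm_exp_mul_mtssTransform_le (hc₁ : 0 ≤ c₁) (hc₂ : 0 ≤ c₂)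
    (hα₁ : α₁ ∈ Ioo (0 : ℝ) 1) (hα₂ : α₂ ∈ Ioo (0 : ℝ) 1) (hl₁ : 0 ≤ l₁) (hl₂ : 0 ≤ l₂)
    (ht : 0 ≤ t) {x : ℝ} (hx : 0 < x) :
    ∃ M, ∀ v y : ℝ, 0 ≤ v → 0 ≤ y →
      ‖Complex.exp (x * (-v + y * Complex.I))
        * mtssTransform c₁ c₂ α₁ α₂ l₁ l₂ t (-v + y * Complex.I)‖
        ≤ M * Real.exp (-(x / 2) * v) := by
  obtain ⟨K₁, hK₁, h₁⟩ := exists_neg_rpow_le_re_cpow hα₁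
  obtain ⟨K₂, hK₂, h₂⟩ := exists_neg_rpow_le_re_cpow hα₂
  -- each of the two power terms uses up a quarter of the decay rate `x` of the exponential
  obtain ⟨B₁, hB₁⟩ := exists_mul_rpow_le_linear hα₁.2 hα₁.1 (t * c₁ * K₁) (by positivity)
    (a := x / 4) (by positivity)
  obtain ⟨B₂, hB₂⟩ := exists_mul_rpow_le_linear hα₂.2 hα₂.1 (t * c₂ * K₂) (by positivity)
    (a := x / 4) (by positivity)
  refine ⟨Real.exp (t * (c₁ * l₁ ^ α₁ + c₂ * l₂ ^ α₂)) * Real.exp (B₁ + B₂),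
    fun v y hv hy => ?_⟩
  have e₁ := h₁ (-v + y * Complex.I + l₁) (by simpa using hy) v hv (by simpa using hl₁)
  have e₂ := h₂ (-v + y * Complex.I + l₂) (by simpa using hy) v hv (by simpa using hl₂)
  have hre : ((x : ℂ) * (-v + y * Complex.I)).re = -x * v := by simp
  rw [norm_mul, Complex.norm_exp, hre, norm_mtssTransform]
  simp only [← Real.exp_add]
  refine Real.exp_le_exp.2 ?_
  have f₁ := mul_le_mul_of_nonneg_left e₁ (mul_nonneg ht hc₁)
  have f₂ := mul_le_mul_of_nonneg_left e₂ (mul_nonneg ht hc₂)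
  linarith [hB₁ v hv, hB₂ v hv]

theorem tendsto_re_cpow_vertical {α : ℝ} (hα : α ∈ Ioo (0 : ℝ) 1) (a l : ℝ) :
    Tendsto (fun y : ℝ => ((a + y * Complex.I + l) ^ (α : ℂ)).re) atTop atTop := by
  obtain ⟨δ, hδ, m, hm, h⟩ := exists_sector_le_re_cpow hα
  refine tendsto_atTop_mono' _ ?_ ((tendsto_rpow_atTop hα.1).const_mul_atTop hm)
  filter_upwards [eventually_gt_atTop 0, eventually_ge_atTop (|a + l| / δ)] with y hy hy'
  have := h (a + y * Complex.I + l) (by simpa using hy) (by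
    rw [div_le_iff₀ hδ] at hy'
    simpa [mul_comm] using hy')
  simpa using this

theorem tendsto_mtssTransform_vertical (hc₁ : 0 ≤ c₁) (hc₂ : 0 ≤ c₂) (hc : c₁ + c₂ = 1)
    (hα₁ : α₁ ∈ Ioo (0 : ℝ) 1) (hα₂ : α₂ ∈ Ioo (0 : ℝ) 1) (ht : 0 < t) (a : ℝ) :
    Tendsto (fun y : ℝ => mtssTransform c₁ c₂ α₁ α₂ l₁ l₂ t (a + y * Complex.I))
      atTop (𝓝 0) := by
  rw [tendsto_zero_iff_norm_tendsto_zero]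
  simp only [norm_mtssTransform]
  rw [← mul_zero (Real.exp (t * (c₁ * l₁ ^ α₁ + c₂ * l₂ ^ α₂)))]
  refine (Real.tendsto_exp_atBot.comp ?_).const_mul _
  have h₁ := tendsto_re_cpow_vertical hα₁ a l₁
  have h₂ := tendsto_re_cpow_vertical hα₂ a l₂
  have hsum : Tendsto (fun y : ℝ => c₁ * ((a + y * Complex.I + l₁) ^ (α₁ : ℂ)).re
      + c₂ * ((a + y * Complex.I + l₂) ^ (α₂ : ℂ)).re) atTop atTop := by
    rcases hc₁.eq_or_lt with h | h
    · have h' : 0 < c₂ := by linarith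
      exact tendsto_atTop_add_left_of_le' _ 0 ((h₁.eventually_ge_atTop 0).mono
        fun y hy => mul_nonneg hc₁ hy) (h₂.const_mul_atTop h')
    · exact tendsto_atTop_add_right_of_le' _ 0 (h₁.const_mul_atTop h)
        ((h₂.eventually_ge_atTop 0).mono fun y hy => mul_nonneg hc₂ hy)
  exact hsum.const_mul_atTop_of_neg (by linarith)

/-- On the imaginary axis `exp (-t ψ)` decays like a stretched exponential. -/
theorem integrableOn_mtssTransform_imaginary_axis
    (hc₁ : 0 ≤ c₁) (hc₂ : 0 ≤ c₂) (hc : c₁ + c₂ = 1)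
    (hα₁ : α₁ ∈ Ioo (0 : ℝ) 1) (hα₂ : α₂ ∈ Ioo (0 : ℝ) 1) (hl₁ : 0 ≤ l₁) (hl₂ : 0 ≤ l₂)
    (ht : 0 < t) :
    IntegrableOn (fun u : ℝ => mtssTransform c₁ c₂ α₁ α₂ l₁ l₂ t (u * Complex.I)) (Ioi 0) := by
  have hmeas : AEStronglyMeasurable
      (fun u : ℝ => mtssTransform c₁ c₂ α₁ α₂ l₁ l₂ t (u * Complex.I))
      (volume.restrict (Ioi 0)) :=
    ((continuousOn_mtssTransform hα₁.1 hα₂.1).comp (by fun_prop)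
      fun u hu => by simpa using le_of_lt hu).aestronglyMeasurable measurableSet_Ioi
  have hlow : ∀ {α l u : ℝ}, α ∈ Ioo (0 : ℝ) 1 → 0 ≤ l → 0 < u →
      Real.cos (Real.pi / 2 * α) * u ^ α ≤ ((u * Complex.I + l) ^ (α : ℂ)).re := by
    intro α l u hα hl hu
    refine le_trans ?_ (cos_mul_norm_rpow_le_re_cpow hα (by simpa using hl))
    refine mul_le_mul_of_nonneg_left ?_ (cos_pi_div_two_mul_pos hα).le
    refine Real.rpow_le_rpow hu.le ?_ hα.1.le
    have := Complex.abs_im_le_norm (u * Complex.I + l)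
    simpa [abs_of_pos hu] using this
  have hdom : ∀ {c α : ℝ}, 0 < c → α ∈ Ioo (0 : ℝ) 1 → IntegrableOn (fun u : ℝ =>
      Real.exp (t * (c₁ * l₁ ^ α₁ + c₂ * l₂ ^ α₂))
        * Real.exp (-(t * (c * Real.cos (Real.pi / 2 * α))) * u ^ α)) (Ioi 0) := by
    intro c α hc hα
    have := cos_pi_div_two_mul_pos hα
    have h := integrableOn_rpow_mul_exp_neg_mul_rpow (p := α) (s := 0)
      (b := t * (c * Real.cos (Real.pi / 2 * α))) (by norm_num) hα.1 (by positivity)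
    simp only [Real.rpow_zero, one_mul] at h
    exact h.const_mul _
  rcases hc₁.eq_or_lt with h | h
  · refine Integrable.mono' (hdom (show 0 < c₂ by linarith) hα₂) hmeas ?_
    filter_upwards [ae_restrict_mem measurableSet_Ioi] with u hu
    rw [norm_mtssTransform, ← h]
    refine mul_le_mul_of_nonneg_left (Real.exp_le_exp.2 ?_) (Real.exp_nonneg _)
    have := mul_le_mul_of_nonneg_left (hlow hα₂ hl₂ hu) (mul_nonneg ht.le hc₂)
    linarith
  · refine Integrable.mono' (hdom h hα₁) hmeas ?_
    filter_upwards [ae_restrict_mem measurableSet_Ioi] with u hu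
    rw [norm_mtssTransform]
    refine mul_le_mul_of_nonneg_left (Real.exp_le_exp.2 ?_) (Real.exp_nonneg _)
    have h1 := mul_le_mul_of_nonneg_left (hlow hα₁ hl₁ hu) (mul_nonneg ht.le hc₁)
    have h2 := mul_le_mul_of_nonneg_left (hlow hα₂ hl₂ hu) (mul_nonneg ht.le hc₂)
    have h3 : 0 ≤ t * c₂ * (Real.cos (Real.pi / 2 * α₂) * u ^ α₂) := by
      have := (cos_pi_div_two_mul_pos hα₂).le
      have : 0 ≤ u ^ α₂ := Real.rpow_nonneg (le_of_lt hu) _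
      positivity
    linarith

end Transform

/-! ### From the Laplace transform to the characteristic function -/

section Laplace

variable {Ω : Type*} [MeasurableSpace Ω] {P : Measure Ω} {X : Ω → ℝ}

/-- A random variable whose Laplace transform is at most `1` on the positive axis is nonnegative,
by Chernoff's bound. -/
theorem ae_nonneg_of_mgf_le_one [IsProbabilityMeasure P]
    (hint : ∀ s : ℝ, s < 0 → Integrable (fun ω => Real.exp (s * X ω)) P)
    (hle : ∀ s : ℝ, s < 0 → mgf X P s ≤ 1) : ∀ᵐ ω ∂P, 0 ≤ X ω := by
  have hzero : ∀ n : ℕ, P {ω | X ω ≤ -(1 / ((n : ℝ) + 1))} = 0 := by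
    intro n
    set ε : ℝ := 1 / ((n : ℝ) + 1) with hε
    have hε0 : 0 < ε := by positivity
    have hlim : Tendsto (fun k : ℝ => Real.exp (-(k * ε))) atTop (𝓝 0) :=
      Real.tendsto_exp_neg_atTop_nhds_zero.comp (tendsto_id.atTop_mul_const hε0)
    have hbound : ∀ᶠ k : ℝ in atTop, P.real {ω | X ω ≤ -ε} ≤ Real.exp (-(k * ε)) := by
      filter_upwards [eventually_gt_atTop 0] with k hk
      have h := measure_le_le_exp_mul_mgf (μ := P) (X := X) (-ε) (t := -k) (by linarith)
        (hint (-k) (by linarith))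
      have h1 := hle (-k) (by linarith)
      refine h.trans ?_
      calc Real.exp (-(-k) * -ε) * mgf X P (-k) ≤ Real.exp (-(-k) * -ε) * 1 := by gcongr
        _ = Real.exp (-(k * ε)) := by rw [mul_one]; ring_nf
    have h0 : P.real {ω | X ω ≤ -ε} ≤ 0 := ge_of_tendsto hlim hbound
    exact (measureReal_eq_zero_iff).1 (le_antisymm h0 measureReal_nonneg)
  have hall := ae_all_iff.2 fun n : ℕ => measure_eq_zero_iff_ae_notMem.1 (hzero n)
  filter_upwards [hall] with ω hω
  by_contra hneg
  obtain ⟨n, hn⟩ := exists_nat_one_div_lt (show 0 < -X ω by linarith [not_le.1 hneg])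
  exact hω n (show X ω ≤ _ by linarith)

/-- The Laplace transform on the positive axis determines the characteristic function: the two
sides agree on the right half-plane by the identity theorem, and then on its boundary by
continuity. -/
theorem charFun_map_eq_mtssTransform [IsProbabilityMeasure P] {c₁ c₂ α₁ α₂ l₁ l₂ t : ℝ}
    (hα₁ : 0 < α₁) (hα₂ : 0 < α₂) (hl₁ : 0 ≤ l₁) (hl₂ : 0 ≤ l₂) (hX : Measurable X)
    (hlap : ∀ s : ℝ, 0 < s → ∫ ω, Real.exp (-s * X ω) ∂P
      = Real.exp (-t * mtssExponent c₁ c₂ α₁ α₂ l₁ l₂ s))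
    (hpos : ∀ᵐ ω ∂P, 0 ≤ X ω) {u : ℝ} (hu : 0 ≤ u) :
    charFun (P.map X) (-u) = mtssTransform c₁ c₂ α₁ α₂ l₁ l₂ t (u * Complex.I) := by
  have hint : ∀ s : ℝ, 0 < s → Integrable (fun ω => Real.exp (-s * X ω)) P := fun s hs =>
    Integrable.of_integral_ne_zero (by rw [hlap s hs]; exact (Real.exp_pos _).ne')
  have hsub : Iio (0 : ℝ) ⊆ interior (integrableExpSet X P) :=
    interior_maximal (fun s hs => by
      have := hint (-s) (by simpa using hs)
      rwa [neg_neg] at this) isOpen_Iio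
  have hopen : IsOpen {z : ℂ | z.re < 0} := isOpen_lt Complex.continuous_re continuous_const
  have hconv : Convex ℝ {z : ℂ | z.re < 0} := convex_halfSpace_re_lt 0
  have heq : EqOn (complexMGF X P) (fun z => mtssTransform c₁ c₂ α₁ α₂ l₁ l₂ t (-z))
      {z : ℂ | z.re < 0} := by
    refine AnalyticOnNhd.eqOn_of_preconnected_of_frequently_eq (z₀ := ((-1 : ℝ) : ℂ))
      (analyticOnNhd_complexMGF.mono fun z hz => hsub hz)
      (DifferentiableOn.analyticOnNhd ?_ hopen) hconv.isPreconnected (by simp) ?_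
    · refine (differentiableOn_mtssTransform hl₁ hl₂).comp (by fun_prop) fun z hz => ?_
      left
      simpa using hz
    · have hmap : Tendsto (fun r : ℝ => (r : ℂ)) (𝓝[≠] (-1)) (𝓝[≠] ((-1 : ℝ) : ℂ)) :=
        tendsto_nhdsWithin_of_tendsto_nhds_of_eventually_within _
          (Complex.continuous_ofReal.continuousAt.mono_left nhdsWithin_le_nhds)
          (by
            filter_upwards [self_mem_nhdsWithin] with r hr
            exact fun h => hr (Complex.ofReal_injective h))
      refine hmap.frequently (Eventually.frequently ?_)
      filter_upwards [mem_nhdsWithin_of_mem_nhds (Iio_mem_nhds (show (-1 : ℝ) < 0 by norm_num))]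
        with r hr
      have hr' : 0 < -r := by simpa using hr
      have h := hlap (-r) hr'
      rw [neg_neg] at h
      rw [complexMGF_ofReal, mgf, h, ← Complex.ofReal_neg, mtssTransform_ofReal hl₁ hl₂ hr'.le]
  -- approach the imaginary axis from the right half-plane
  obtain ⟨e, he, hε⟩ : ∃ e : ℕ → ℝ, (∀ n, 0 < e n) ∧ Tendsto e atTop (𝓝 0) :=
    ⟨fun n => 1 / ((n : ℝ) + 1), fun n => by positivity, tendsto_one_div_add_atTop_nhds_zero_nat⟩
  have hlimL : Tendsto (fun n : ℕ => complexMGF X P (-((e n : ℂ) + u * Complex.I)))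
      atTop (𝓝 (complexMGF X P ((-u : ℝ) * Complex.I))) := by
    refine tendsto_integral_of_dominated_convergence (fun _ => 1) (fun n => ?_)
      (integrable_const _) (fun n => ?_) ?_
    · exact (by fun_prop : Measurable _).aestronglyMeasurable
    · filter_upwards [hpos] with ω hω
      rw [Complex.norm_exp, Real.exp_le_one_iff]
      have : ((-((e n : ℂ) + u * Complex.I)) * (X ω : ℂ)).re
          = -e n * X ω := by simp
      rw [this, neg_mul]
      exact neg_nonpos.2 (mul_nonneg (he n).le hω)
    · refine Eventually.of_forall fun ω => ?_
      have hc : Continuous fun r : ℝ => Complex.exp (-((r : ℂ) + u * Complex.I) * X ω) := by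
        fun_prop
      have := (hc.tendsto 0).comp hε
      simpa [Function.comp_def] using this
  have hlimR : Tendsto (fun n : ℕ => mtssTransform c₁ c₂ α₁ α₂ l₁ l₂ t
      (e n + u * Complex.I)) atTop
      (𝓝 (mtssTransform c₁ c₂ α₁ α₂ l₁ l₂ t (u * Complex.I))) := by
    have hw := continuousOn_mtssTransform (c₁ := c₁) (c₂ := c₂) (l₁ := l₁) (l₂ := l₂) (t := t)
      hα₁ hα₂ (u * Complex.I) (by simpa using hu)
    refine hw.tendsto.comp (tendsto_nhdsWithin_iff.2 ⟨?_, Eventually.of_forall fun n => ?_⟩)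
    · have hc : Continuous fun r : ℝ => (r : ℂ) + u * Complex.I := by fun_prop
      have := (hc.tendsto 0).comp hε
      simpa [Function.comp_def] using this
    · simpa using hu
  rw [← complexMGF_mul_I hX.aemeasurable]
  refine tendsto_nhds_unique hlimL (hlimR.congr fun n => ?_)
  have := heq (x := -(e n + u * Complex.I)) (by
    simpa using he n)
  simp only [neg_neg] at this
  exact this.symm

end Laplace

/-! ### The density as an integral along the cut -/

theorem integrable_of_conj_symm {k : ℝ → ℂ} (hk : ∀ u, k u = (starRingEnd ℂ) (k (-u)))
    (hint : IntegrableOn (fun u => k (-u)) (Ioi 0)) : Integrable k := by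
  have hIic : IntegrableOn k (Iic 0) := by
    have h := IntegrableOn.comp_neg_Iio (c := (0 : ℝ)) (f := fun u => k (-u)) (by rwa [neg_zero])
    simp only [neg_neg] at h
    exact Iff.mpr integrableOn_Iic_iff_integrableOn_Iio h
  have hIoi : IntegrableOn k (Ioi 0) := by
    have h : IntegrableOn (fun u => (starRingEnd ℂ) (k (-u))) (Ioi 0) :=
      (Complex.conjLIE.toContinuousLinearEquiv.toContinuousLinearMap).integrable_comp hint
    exact h.congr_fun (fun u _ => (hk u).symm) measurableSet_Ioi
  rw [← integrableOn_univ, ← Iic_union_Ioi (a := (0 : ℝ))]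
  exact hIic.union hIoi

theorem re_integral_of_conj_symm {k : ℝ → ℂ} (hk : ∀ u, k u = (starRingEnd ℂ) (k (-u)))
    (hint : IntegrableOn (fun u => k (-u)) (Ioi 0)) :
    (∫ u, k u).re = 2 * (∫ u in Ioi (0 : ℝ), k (-u)).re := by
  have hI := integrable_of_conj_symm hk hint
  have h1 : ∫ u in Iic (0 : ℝ), k u = ∫ u in Ioi (0 : ℝ), k (-u) := by
    simp
  have h2 : ∫ u in Ioi (0 : ℝ), k u = (starRingEnd ℂ) (∫ u in Ioi (0 : ℝ), k (-u)) := by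
    rw [← integral_conj]
    exact setIntegral_congr_fun measurableSet_Ioi fun u _ => hk u
  rw [← intervalIntegral.integral_Iic_add_Ioi hI.integrableOn hI.integrableOn, h1, h2,
    Complex.add_re, Complex.conj_re]
  ring

section Density

variable {Ω : Type*} [MeasurableSpace Ω] {P : Measure Ω} {X : Ω → ℝ}
  {c₁ c₂ α₁ α₂ l₁ l₂ t : ℝ}

open FourierTransform in
/-- Fourier inversion with the contour turned from the imaginary axis onto the upper side of the
cut. -/
theorem hasContinuousDensityOnPos_cut_integral [IsProbabilityMeasure P]
    (hc₁ : 0 ≤ c₁) (hc₂ : 0 ≤ c₂) (hc : c₁ + c₂ = 1)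
    (hα₁ : α₁ ∈ Ioo (0 : ℝ) 1) (hα₂ : α₂ ∈ Ioo (0 : ℝ) 1)
    (hl₁ : 0 ≤ l₁) (hl₂ : 0 ≤ l₂) (ht : 0 < t) (hX : Measurable X)
    (hlap : ∀ s : ℝ, 0 < s → ∫ ω, Real.exp (-s * X ω) ∂P
      = Real.exp (-t * mtssExponent c₁ c₂ α₁ α₂ l₁ l₂ s))
    {g : ℝ → ℝ} (hg : ∀ x, 0 < x → g x = 1 / Real.pi * -(∫ v in Ioi (0 : ℝ),
      Complex.exp (x * -v) * mtssTransform c₁ c₂ α₁ α₂ l₁ l₂ t (-v)).im) :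
    HasContinuousDensityOnPos P X g := by
  have hint : ∀ s : ℝ, 0 < s → Integrable (fun ω => Real.exp (-s * X ω)) P := fun s hs =>
    Integrable.of_integral_ne_zero (by rw [hlap s hs]; exact (Real.exp_pos _).ne')
  have hpos : ∀ᵐ ω ∂P, 0 ≤ X ω := by
    refine ae_nonneg_of_mgf_le_one (fun s hs => ?_) fun s hs => ?_
    · simpa using hint (-s) (by linarith)
    · have h := hlap (-s) (by linarith)
      rw [neg_neg] at h
      rw [mgf, h, Real.exp_le_one_iff, neg_mul, neg_nonpos, mtssExponent]
      have h1 : l₁ ^ α₁ ≤ (-s + l₁) ^ α₁ := Real.rpow_le_rpow hl₁ (by linarith) hα₁.1.le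
      have h2 : l₂ ^ α₂ ≤ (-s + l₂) ^ α₂ := Real.rpow_le_rpow hl₂ (by linarith) hα₂.1.le
      have := sub_nonneg.2 h1
      have := sub_nonneg.2 h2
      positivity
  have hchar : ∀ u : ℝ, 0 ≤ u → charFun (P.map X) (-u)
      = mtssTransform c₁ c₂ α₁ α₂ l₁ l₂ t (u * Complex.I) := fun u hu =>
    charFun_map_eq_mtssTransform hα₁.1 hα₂.1 hl₁ hl₂ hX hlap hpos hu
  have : IsProbabilityMeasure (P.map X) := Measure.isProbabilityMeasure_map hX.aemeasurable
  set μ := P.map X with hμ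
  have hFint := integrableOn_mtssTransform_imaginary_axis hc₁ hc₂ hc hα₁ hα₂ hl₁ hl₂ ht
  have hcint : IntegrableOn (fun u => charFun μ (-u)) (Ioi 0) :=
    hFint.congr_fun (fun u hu => (hchar u (le_of_lt hu)).symm) measurableSet_Ioi
  have hφ : Integrable (charFun μ) :=
    integrable_of_conj_symm (fun u => by rw [charFun_neg, Complex.conj_conj]) hcint
  set f : ℝ → ℝ := fun x => (𝓕 (fun w : ℝ => charFun μ (2 * Real.pi * w)) x).re with hf
  obtain ⟨hfc, hfn, hfd⟩ := eq_withDensity_of_integrable_charFun hφ (f := f) fun _ => rfl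
  have hfg : ∀ x, 0 < x → f x = g x := by
    intro x hx
    set G : ℂ → ℂ := fun z => Complex.exp (x * z) * mtssTransform c₁ c₂ α₁ α₂ l₁ l₂ t z with hG
    have hGc : ContinuousOn G {z | 0 ≤ z.im} :=
      (by fun_prop : ContinuousOn (fun z : ℂ => Complex.exp (x * z)) _).mul
        (continuousOn_mtssTransform hα₁.1 hα₂.1)
    have hGd : DifferentiableOn ℂ G {z | 0 < z.im} :=
      (by fun_prop : DifferentiableOn ℂ (fun z : ℂ => Complex.exp (x * z)) _).mul
        ((differentiableOn_mtssTransform hl₁ hl₂).mono fun z hz => Or.inr (ne_of_gt hz))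
    obtain ⟨M, hM⟩ := exists_norm_exp_mul_mtssTransform_le hc₁ hc₂ hα₁ hα₂ hl₁ hl₂ ht.le hx
    have hnorm : ∀ u : ℝ, ‖Complex.exp (x * (u * Complex.I))‖ = 1 := fun u => by
      rw [Complex.norm_exp]; simp
    have hGint : IntegrableOn (fun u : ℝ => G (u * Complex.I)) (Ioi 0) := by
      refine hFint.bdd_mul (c := 1) ?_ (Eventually.of_forall fun u => (hnorm u).le)
      exact (by fun_prop : Continuous fun u : ℝ =>
        Complex.exp (x * (u * Complex.I))).aestronglyMeasurable
    have hGlim : ∀ v : ℝ, 0 < v →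
        Tendsto (fun y : ℝ => G (-v + y * Complex.I)) atTop (𝓝 0) := by
      intro v _
      have h := tendsto_mtssTransform_vertical (l₁ := l₁) (l₂ := l₂) hc₁ hc₂ hc hα₁ hα₂ ht (-v)
      rw [tendsto_zero_iff_norm_tendsto_zero] at h ⊢
      have h' := h.const_mul (Real.exp (x * -v))
      rw [mul_zero] at h'
      refine h'.congr fun y => ?_
      rw [hG, norm_mul, Complex.norm_exp]
      simp
    have hrot := integral_imaginary_axis_eq_neg_real_axis hGc hGd (by positivity) hM hGlim hGint
    -- after the substitution `u = 2 π w` the Fourier integrand is `k`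
    set k : ℝ → ℂ := fun u => Complex.exp (-(u * x : ℝ) * Complex.I) * charFun μ u with hkdef
    have hkG : ∀ u : ℝ, 0 < u → k (-u) = G (u * Complex.I) := by
      intro u hu
      simp only [hkdef, hG]
      rw [hchar u hu.le]
      congr 2
      push_cast
      ring
    have hksymm : ∀ u, k u = (starRingEnd ℂ) (k (-u)) := by
      intro u
      simp only [hkdef]
      rw [charFun_neg, map_mul, Complex.conj_conj, ← Complex.exp_conj]
      congr 2
      simp
    have hkint : IntegrableOn (fun u => k (-u)) (Ioi 0) :=
      hGint.congr_fun (fun u hu => (hkG u hu).symm) measurableSet_Ioi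
    have hscale : 𝓕 (fun w : ℝ => charFun μ (2 * Real.pi * w)) x
        = ((2 * Real.pi)⁻¹ : ℝ) • ∫ u, k u := by
      rw [Real.fourier_real_eq_integral_exp_smul,
        ← abs_of_pos (show 0 < (2 * Real.pi)⁻¹ by positivity),
        ← Measure.integral_comp_mul_left k (2 * Real.pi)]
      congr 1 with w
      simp only [hkdef, smul_eq_mul]
      congr 2
      push_cast
      ring
    have hre : (∫ u in Ioi (0 : ℝ), k (-u)).re = -(∫ v in Ioi (0 : ℝ), G (-v)).im := by
      rw [setIntegral_congr_fun measurableSet_Ioi fun u hu => hkG u hu, ← Complex.I_mul_im, hrot,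
        Complex.neg_im]
    rw [hg x hx, hf]
    simp only
    rw [hscale, Complex.smul_re, re_integral_of_conj_symm hksymm hkint, hre, smul_eq_mul]
    have := Real.pi_pos
    simp only [hG]
    field_simp
  refine ⟨fun x hx => hfg x hx ▸ hfn x, hfc.continuousOn.congr fun x hx => (hfg x hx).symm, ?_⟩
  -- nonnegativity excludes `(-∞, 0)`, and the density on the whole line excludes an atom at `0`
  have hneg : μ (Ioi 0)ᶜ = 0 := by
    have h0 : μ {0} = 0 := by rw [hfd]; exact withDensity_absolutelyContinuous _ _ (by simp)
    have h1 : μ (Iio 0) = 0 := by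
      rw [hμ, Measure.map_apply hX measurableSet_Iio, measure_eq_zero_iff_ae_notMem]
      filter_upwards [hpos] with ω hω h
      exact absurd h (not_lt.2 hω)
    rw [compl_Ioi, ← Iio_union_right]
    exact measure_union_null h1 h0
  rw [← hμ, ← Measure.restrict_eq_self_of_ae_mem (μ := μ) (s := Ioi 0) hneg]
  conv_lhs => rw [hfd]
  rw [restrict_withDensity measurableSet_Ioi]
  refine withDensity_congr_ae ?_
  filter_upwards [ae_restrict_mem measurableSet_Ioi] with x hx
  rw [hfg x hx]

end Density

/-! ### Boundary values on the cut -/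

theorem re_cpow_ofReal_of_nonneg {w : ℝ} (hw : 0 ≤ w) (α : ℝ) :
    ((w : ℂ) ^ (α : ℂ)).re = w ^ α := by
  rw [← Complex.ofReal_cpow hw, Complex.ofReal_re]

theorem im_cpow_ofReal_of_nonneg {w : ℝ} (hw : 0 ≤ w) (α : ℝ) :
    ((w : ℂ) ^ (α : ℂ)).im = 0 := by
  rw [← Complex.ofReal_cpow hw, Complex.ofReal_im]

theorem re_cpow_ofReal_neg {w : ℝ} (hw : 0 < w) (α : ℝ) :
    (((-w : ℝ) : ℂ) ^ (α : ℂ)).re = w ^ α * Real.cos (Real.pi * α) := by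
  rw [Complex.cpow_ofReal_re, Complex.arg_ofReal_of_neg (neg_lt_zero.2 hw), Complex.norm_real,
    norm_neg, Real.norm_of_nonneg hw.le]

theorem im_cpow_ofReal_neg {w : ℝ} (hw : 0 < w) (α : ℝ) :
    (((-w : ℝ) : ℂ) ^ (α : ℂ)).im = w ^ α * Real.sin (Real.pi * α) := by
  rw [Complex.cpow_ofReal_im, Complex.arg_ofReal_of_neg (neg_lt_zero.2 hw), Complex.norm_real,
    norm_neg, Real.norm_of_nonneg hw.le]

section Cut

variable {c₁ c₂ α₁ α₂ l₁ l₂ t x : ℝ}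

theorem im_mtssTransform (z : ℂ) :
    (mtssTransform c₁ c₂ α₁ α₂ l₁ l₂ t z).im
      = -(Real.exp (t * (c₁ * l₁ ^ α₁ + c₂ * l₂ ^ α₂))
        * Real.exp (-t * (c₁ * ((z + l₁) ^ (α₁ : ℂ)).re + c₂ * ((z + l₂) ^ (α₂ : ℂ)).re))
        * Real.sin (t * (c₁ * ((z + l₁) ^ (α₁ : ℂ)).im + c₂ * ((z + l₂) ^ (α₂ : ℂ)).im))) := by
  rw [← norm_mtssTransform, ← mul_neg, ← Real.sin_neg, mtssTransform, Complex.norm_exp,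
    Complex.exp_im]
  congr 2
  rw [← Complex.ofReal_neg, Complex.im_ofReal_mul, Complex.add_im, Complex.im_ofReal_mul,
    Complex.im_ofReal_mul, Complex.sub_im, Complex.sub_im, Complex.ofReal_im, Complex.ofReal_im]
  ring

theorem im_exp_mul_mtssTransform_neg (v : ℝ) :
    (Complex.exp (x * -v) * mtssTransform c₁ c₂ α₁ α₂ l₁ l₂ t (-v)).im
      = -(Real.exp (-x * v) * (Real.exp (t * (c₁ * l₁ ^ α₁ + c₂ * l₂ ^ α₂))
        * Real.exp (-t * (c₁ * (((l₁ - v : ℝ) : ℂ) ^ (α₁ : ℂ)).re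
          + c₂ * (((l₂ - v : ℝ) : ℂ) ^ (α₂ : ℂ)).re))
        * Real.sin (t * (c₁ * (((l₁ - v : ℝ) : ℂ) ^ (α₁ : ℂ)).im
          + c₂ * (((l₂ - v : ℝ) : ℂ) ^ (α₂ : ℂ)).im)))) := by
  have h : Complex.exp (x * -v) = (Real.exp (-x * v) : ℝ) := by
    push_cast
    ring_nf
  have hl : ∀ l : ℝ, (-v + l : ℂ) = ((l - v : ℝ) : ℂ) := fun l => by push_cast; ring
  rw [h, Complex.im_ofReal_mul, im_mtssTransform, hl, hl, mul_neg]

/-- Before the first branch point both principal powers are real. -/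
theorem im_cut_before (hle : l₁ ≤ l₂) {v : ℝ} (hv : v ≤ l₁) :
    (Complex.exp (x * -v) * mtssTransform c₁ c₂ α₁ α₂ l₁ l₂ t (-v)).im = 0 := by
  rw [im_exp_mul_mtssTransform_neg, im_cpow_ofReal_of_nonneg (by linarith),
    im_cpow_ofReal_of_nonneg (by linarith)]
  simp

theorem im_cut_inner {w : ℝ} (hw : w ∈ Ioo 0 (l₂ - l₁)) :
    (Complex.exp (x * -((l₁ + w : ℝ) : ℂ))
      * mtssTransform c₁ c₂ α₁ α₂ l₁ l₂ t (-((l₁ + w : ℝ) : ℂ))).im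
      = -mtssInnerIntegrand c₁ c₂ α₁ α₂ l₁ l₂ x t w := by
  have e₁ : l₁ - (l₁ + w) = -w := by ring
  have e₂ : l₂ - (l₁ + w) = l₂ - l₁ - w := by ring
  have h2 : 0 ≤ l₂ - l₁ - w := by linarith [hw.2]
  have e₃ : Real.exp (-x * (l₁ + w)) = Real.exp (-x * l₁) * Real.exp (-w * x) := by
    rw [← Real.exp_add]; ring_nf
  rw [im_exp_mul_mtssTransform_neg, e₁, e₂, re_cpow_ofReal_neg hw.1, im_cpow_ofReal_neg hw.1,
    re_cpow_ofReal_of_nonneg h2, im_cpow_ofReal_of_nonneg h2, mtssInnerIntegrand, e₃]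
  ring_nf

theorem im_cut_outer (hle : l₁ ≤ l₂) {w : ℝ} (hw : 0 < w) :
    (Complex.exp (x * -((l₂ + w : ℝ) : ℂ))
      * mtssTransform c₁ c₂ α₁ α₂ l₁ l₂ t (-((l₂ + w : ℝ) : ℂ))).im
      = -mtssOuterIntegrand c₁ c₂ α₁ α₂ l₁ l₂ x t w := by
  have e₁ : l₁ - (l₂ + w) = -(l₂ - l₁ + w) := by ring
  have e₂ : l₂ - (l₂ + w) = -w := by ring
  have h1 : 0 < l₂ - l₁ + w := by linarith
  have e₃ : Real.exp (-x * (l₂ + w)) = Real.exp (-x * l₂) * Real.exp (-w * x) := by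
    rw [← Real.exp_add]; ring_nf
  rw [im_exp_mul_mtssTransform_neg, e₁, e₂, re_cpow_ofReal_neg hw, im_cpow_ofReal_neg hw,
    re_cpow_ofReal_neg h1, im_cpow_ofReal_neg h1, mtssOuterIntegrand, e₃]
  ring_nf

theorem integrableOn_cut (hc₁ : 0 ≤ c₁) (hc₂ : 0 ≤ c₂)
    (hα₁ : α₁ ∈ Ioo (0 : ℝ) 1) (hα₂ : α₂ ∈ Ioo (0 : ℝ) 1) (hl₁ : 0 ≤ l₁) (hl₂ : 0 ≤ l₂)
    (ht : 0 ≤ t) (hx : 0 < x) :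
    IntegrableOn (fun v : ℝ => Complex.exp (x * -v) * mtssTransform c₁ c₂ α₁ α₂ l₁ l₂ t (-v))
      (Ioi 0) := by
  obtain ⟨M, hM⟩ := exists_norm_exp_mul_mtssTransform_le hc₁ hc₂ hα₁ hα₂ hl₁ hl₂ ht hx
  exact integrableOn_neg_ray_of_bound
    (G := fun z => Complex.exp (x * z) * mtssTransform c₁ c₂ α₁ α₂ l₁ l₂ t z)
    ((by fun_prop : ContinuousOn (fun z : ℂ => Complex.exp (x * z)) _).mul
      (continuousOn_mtssTransform hα₁.1 hα₂.1)) (by positivity) hM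

theorem integrableOn_mtssOuterIntegrand (hc₁ : 0 ≤ c₁) (hc₂ : 0 ≤ c₂)
    (hα₁ : α₁ ∈ Ioo (0 : ℝ) 1) (hα₂ : α₂ ∈ Ioo (0 : ℝ) 1) (hl₁ : 0 ≤ l₁) (hle : l₁ ≤ l₂)
    (ht : 0 ≤ t) (hx : 0 < x) :
    IntegrableOn (fun w => mtssOuterIntegrand c₁ c₂ α₁ α₂ l₁ l₂ x t w) (Ioi 0) := by
  have h := (integrableOn_cut hc₁ hc₂ hα₁ hα₂ hl₁ (hl₁.trans hle) ht hx).im.neg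
  have h' : IntegrableOn _ (Ioi l₂) :=
    IntegrableOn.mono_set h (Ioi_subset_Ioi (hl₁.trans hle))
  rw [← (measurePreserving_add_left volume l₂).integrableOn_comp_preimage
    (measurableEmbedding_addLeft l₂), preimage_const_add_Ioi, sub_self] at h'
  refine h'.congr_fun (fun w hw => ?_) measurableSet_Ioi
  exact (neg_eq_iff_eq_neg.2 (im_cut_outer hle hw))

theorem integrableOn_mtssInnerIntegrand (hc₁ : 0 ≤ c₁) (hc₂ : 0 ≤ c₂)
    (hα₁ : α₁ ∈ Ioo (0 : ℝ) 1) (hα₂ : α₂ ∈ Ioo (0 : ℝ) 1) (hl₁ : 0 ≤ l₁) (hle : l₁ ≤ l₂)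
    (ht : 0 ≤ t) (hx : 0 < x) :
    IntegrableOn (fun w => mtssInnerIntegrand c₁ c₂ α₁ α₂ l₁ l₂ x t w) (Ioo 0 (l₂ - l₁)) := by
  have h := (integrableOn_cut hc₁ hc₂ hα₁ hα₂ hl₁ (hl₁.trans hle) ht hx).im.neg
  have h' : IntegrableOn _ (Ioo l₁ l₂) :=
    IntegrableOn.mono_set h (Ioo_subset_Ioi_self.trans (Ioi_subset_Ioi hl₁))
  rw [← (measurePreserving_add_left volume l₁).integrableOn_comp_preimage
    (measurableEmbedding_addLeft l₁), preimage_const_add_Ioo, sub_self] at h'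
  refine h'.congr_fun (fun w hw => ?_) measurableSet_Ioo
  exact (neg_eq_iff_eq_neg.2 (im_cut_inner hw))

/-- The cut integral splits at the two branch points `-l₁` and `-l₂`; the part of `(-∞, 0]` before
the first of them does not contribute. -/
theorem mtssDensityOfLT_eq_cut_integral (hc₁ : 0 ≤ c₁) (hc₂ : 0 ≤ c₂)
    (hα₁ : α₁ ∈ Ioo (0 : ℝ) 1) (hα₂ : α₂ ∈ Ioo (0 : ℝ) 1) (hl₁ : 0 ≤ l₁) (hle : l₁ ≤ l₂)
    (ht : 0 ≤ t) (hx : 0 < x) :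
    mtssDensityOfLT c₁ c₂ α₁ α₂ l₁ l₂ x t = 1 / Real.pi * -(∫ v in Ioi (0 : ℝ),
      Complex.exp (x * -v) * mtssTransform c₁ c₂ α₁ α₂ l₁ l₂ t (-v)).im := by
  have hint := integrableOn_cut hc₁ hc₂ hα₁ hα₂ hl₁ (hl₁.trans hle) ht hx
  set H : ℝ → ℂ := fun v => Complex.exp (x * -v) * mtssTransform c₁ c₂ α₁ α₂ l₁ l₂ t (-v) with hH
  have him : (∫ v in Ioi (0 : ℝ), H v).im = ∫ v in Ioi (0 : ℝ), (H v).im :=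
    (Complex.imCLM.integral_comp_comm hint).symm
  have hI : IntegrableOn (fun v => (H v).im) (Ioi 0) := hint.im
  have h0 : ∫ v in Ioc 0 l₁, (H v).im = 0 := by
    rw [setIntegral_congr_fun measurableSet_Ioc fun v hv => im_cut_before hle hv.2]
    simp
  have h1 : ∫ v in Ioc l₁ l₂, (H v).im
      = -∫ w in Ioo (0 : ℝ) (l₂ - l₁), mtssInnerIntegrand c₁ c₂ α₁ α₂ l₁ l₂ x t w := by
    rw [integral_Ioc_eq_integral_Ioo, ← integral_neg,
      ← (measurePreserving_add_left volume l₁).setIntegral_preimage_emb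
        (measurableEmbedding_addLeft l₁), preimage_const_add_Ioo, sub_self]
    exact setIntegral_congr_fun measurableSet_Ioo fun w hw => im_cut_inner hw
  have h2 : ∫ v in Ioi l₂, (H v).im
      = -∫ w in Ioi (0 : ℝ), mtssOuterIntegrand c₁ c₂ α₁ α₂ l₁ l₂ x t w := by
    rw [← integral_neg,
      ← (measurePreserving_add_left volume l₂).setIntegral_preimage_emb
        (measurableEmbedding_addLeft l₂), preimage_const_add_Ioi, sub_self]
    exact setIntegral_congr_fun measurableSet_Ioi fun w hw => im_cut_outer hle hw
  have hs1 : ∫ v in Ioi (0 : ℝ), (H v).im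
      = (∫ v in Ioc 0 l₁, (H v).im) + ∫ v in Ioi l₁, (H v).im := by
    rw [← Ioc_union_Ioi_eq_Ioi hl₁]
    exact setIntegral_union Ioc_disjoint_Ioi_same measurableSet_Ioi
      (hI.mono_set Ioc_subset_Ioi_self) (hI.mono_set (Ioi_subset_Ioi hl₁))
  have hs2 : ∫ v in Ioi l₁, (H v).im
      = (∫ v in Ioc l₁ l₂, (H v).im) + ∫ v in Ioi l₂, (H v).im := by
    rw [← Ioc_union_Ioi_eq_Ioi hle]
    exact setIntegral_union Ioc_disjoint_Ioi_same measurableSet_Ioi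
      (hI.mono_set (Ioc_subset_Ioi_self.trans (Ioi_subset_Ioi hl₁)))
      (hI.mono_set (Ioi_subset_Ioi (hl₁.trans hle)))
  rw [him, hs1, hs2, h0, h1, h2, mtssDensityOfLT]
  ring

end Cut

theorem mtssEqIntegrand_eq_mtssOuterIntegrand (c₁ c₂ α₁ α₂ l x t w : ℝ) :
    mtssEqIntegrand c₁ c₂ α₁ α₂ l x t w = mtssOuterIntegrand c₁ c₂ α₁ α₂ l l x t w := by
  simp only [mtssEqIntegrand, mtssOuterIntegrand, sub_self, zero_add]

/-- For equal tempering parameters the inner interval `(0, l₂ - l₁)` is empty. -/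
theorem mtssDensityOfEq_eq_mtssDensityOfLT (c₁ c₂ α₁ α₂ l x t : ℝ) :
    mtssDensityOfEq c₁ c₂ α₁ α₂ l x t = mtssDensityOfLT c₁ c₂ α₁ α₂ l l x t := by
  simp [mtssDensityOfEq, mtssDensityOfLT, mtssEqIntegrand_eq_mtssOuterIntegrand]

/-! ### Binomial expansions -/

theorem hasSum_binomial_rpow (α : ℝ) {y : ℝ} (hy : |y| < 1) :
    HasSum (fun k : ℕ => Ring.choose α k * y ^ k) ((1 + y) ^ α) := by
  have h := (Real.one_add_rpow_hasFPowerSeriesOnBall_zero (a := α)).hasSum (y := y)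
    (by simpa [Metric.mem_eball, edist_dist, Real.dist_eq] using hy)
  simpa only [binomialSeries_apply, List.ofFn_const, List.prod_replicate, zero_add,
    smul_eq_mul] using h

theorem hasSum_binomial_add_rpow (α : ℝ) {d w : ℝ} (hw : 0 ≤ w) (hwd : w < d) :
    HasSum (fun k : ℕ => d ^ α *
      (Ring.choose α k * (w ^ k / (-d) ^ k) * Real.cos (Real.pi * k))) ((d + w) ^ α) := by
  have hd : 0 < d := hw.trans_lt hwd
  have hy : |w / d| < 1 := by rwa [abs_of_nonneg (by positivity), div_lt_one hd]
  have h := (hasSum_binomial_rpow α hy).mul_left (d ^ α)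
  rw [← Real.mul_rpow hd.le (by positivity), mul_add, mul_one, mul_div_cancel₀ w hd.ne'] at h
  refine h.congr_fun fun k => ?_
  rw [mul_comm Real.pi, Real.cos_nat_mul_pi, neg_pow d, div_pow]
  rcases neg_one_pow_eq_or ℝ k with h | h <;> rw [h] <;> field_simp

theorem hasSum_binomial_sub_rpow (α : ℝ) {d w : ℝ} (hw : 0 ≤ w) (hwd : w < d) :
    HasSum (fun k : ℕ => d ^ α *
      (Ring.choose α k * (w ^ k / d ^ k) * Real.cos (Real.pi * k))) ((d - w) ^ α) := by
  have hd : 0 < d := hw.trans_lt hwd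
  have hy : |-(w / d)| < 1 := by rwa [abs_neg, abs_of_nonneg (by positivity), div_lt_one hd]
  have h := (hasSum_binomial_rpow α hy).mul_left (d ^ α)
  have h1 : 0 ≤ 1 + -(w / d) := by linarith [(abs_lt.1 hy).1]
  rw [← Real.mul_rpow hd.le h1, mul_add, mul_one, mul_neg, mul_div_cancel₀ w hd.ne',
    ← sub_eq_add_neg] at h
  refine h.congr_fun fun k => ?_
  rw [mul_comm Real.pi, Real.cos_nat_mul_pi, neg_pow (w / d), div_pow]
  ring

/-! ### The mixture tempered stable subordinator -/

section Subordinator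

variable {Ω : Type*} [MeasurableSpace Ω] {P : Measure Ω}
  {c₁ c₂ α₁ α₂ l₁ l₂ : ℝ} {S : ℝ≥0 → Ω → ℝ}

theorem IsMTSS.swap (hS : IsMTSS P c₁ c₂ α₁ α₂ l₁ l₂ S) : IsMTSS P c₂ c₁ α₂ α₁ l₂ l₁ S :=
  ⟨hS.levy, fun t s hs => by
    rw [hS.laplace t s hs, mtssExponent, mtssExponent, add_comm]⟩

theorem IsMTSS.hasContinuousDensityOnPos [IsProbabilityMeasure P]
    (hS : IsMTSS P c₁ c₂ α₁ α₂ l₁ l₂ S)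
    (hc₁ : 0 ≤ c₁) (hc₂ : 0 ≤ c₂) (hc : c₁ + c₂ = 1)
    (hα₁ : α₁ ∈ Ioo (0 : ℝ) 1) (hα₂ : α₂ ∈ Ioo (0 : ℝ) 1) (hl₁ : 0 ≤ l₁) (hle : l₁ ≤ l₂)
    {t : ℝ≥0} (ht : 0 < t) :
    HasContinuousDensityOnPos P (S t) (fun x => mtssDensityOfLT c₁ c₂ α₁ α₂ l₁ l₂ x t) :=
  hasContinuousDensityOnPos_cut_integral hc₁ hc₂ hc hα₁ hα₂ hl₁ (hl₁.trans hle)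
    (NNReal.coe_pos.2 ht) (hS.levy.measurable t) (hS.laplace t) fun _ hx =>
      mtssDensityOfLT_eq_cut_integral hc₁ hc₂ hα₁ hα₂ hl₁ hle t.coe_nonneg hx

theorem IsMTSS.representation_of_lt [IsProbabilityMeasure P]
    (hS : IsMTSS P c₁ c₂ α₁ α₂ l₁ l₂ S)
    (hc₁ : 0 ≤ c₁) (hc₂ : 0 ≤ c₂) (hc : c₁ + c₂ = 1)
    (hα₁ : α₁ ∈ Ioo (0 : ℝ) 1) (hα₂ : α₂ ∈ Ioo (0 : ℝ) 1) (hl₁ : 0 ≤ l₁) (hlt : l₁ < l₂)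
    {t : ℝ≥0} (ht : 0 < t) :
    (∀ x : ℝ, 0 < x →
      IntegrableOn (fun w => mtssOuterIntegrand c₁ c₂ α₁ α₂ l₁ l₂ x t w) (Ioi 0) ∧
      IntegrableOn (fun w => mtssInnerIntegrand c₁ c₂ α₁ α₂ l₁ l₂ x t w)
        (Ioo 0 (l₂ - l₁))) ∧
    HasContinuousDensityOnPos P (S t) (fun x => mtssDensityOfLT c₁ c₂ α₁ α₂ l₁ l₂ x t) ∧
    (∀ w : ℝ, 0 ≤ w → w < l₂ - l₁ →
      HasSum (fun k : ℕ => (l₂ - l₁) ^ α₁ *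
        (Ring.choose α₁ k * (w ^ k / (l₁ - l₂) ^ k) * Real.cos (Real.pi * k)))
        ((l₂ - l₁ + w) ^ α₁) ∧
      HasSum (fun k : ℕ => (l₂ - l₁) ^ α₂ *
        (Ring.choose α₂ k * (w ^ k / (l₂ - l₁) ^ k) * Real.cos (Real.pi * k)))
        ((l₂ - l₁ - w) ^ α₂)) := by
  refine ⟨fun x hx => ⟨?_, ?_⟩,
    hS.hasContinuousDensityOnPos hc₁ hc₂ hc hα₁ hα₂ hl₁ hlt.le ht, fun w hw hwd => ⟨?_, ?_⟩⟩
  · exact integrableOn_mtssOuterIntegrand hc₁ hc₂ hα₁ hα₂ hl₁ hlt.le t.coe_nonneg hx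
  · exact integrableOn_mtssInnerIntegrand hc₁ hc₂ hα₁ hα₂ hl₁ hlt.le t.coe_nonneg hx
  · rw [← neg_sub l₂ l₁]
    exact hasSum_binomial_add_rpow α₁ hw hwd
  · exact hasSum_binomial_sub_rpow α₂ hw hwd

end Subordinator

theorem proposition3p1 {Ω : Type*} [MeasurableSpace Ω] (P : Measure Ω) [IsProbabilityMeasure P]
    (c₁ c₂ α₁ α₂ l₁ l₂ : ℝ)
    (hc₁ : 0 ≤ c₁) (hc₂ : 0 ≤ c₂) (hc : c₁ + c₂ = 1)
    (hα₁ : α₁ ∈ Ioo (0 : ℝ) 1) (hα₂ : α₂ ∈ Ioo (0 : ℝ) 1)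
    (hl₁ : 0 ≤ l₁) (hl₂ : 0 ≤ l₂)
    (S : ℝ≥0 → Ω → ℝ) (hS : IsMTSS P c₁ c₂ α₁ α₂ l₁ l₂ S)
    (t : ℝ≥0) (ht : 0 < t) :
    -- distinct tempering parameters, `l₁ < l₂`
    (l₁ < l₂ →
      (∀ x : ℝ, 0 < x →
        IntegrableOn (fun w => mtssOuterIntegrand c₁ c₂ α₁ α₂ l₁ l₂ x t w) (Ioi 0) ∧
        IntegrableOn (fun w => mtssInnerIntegrand c₁ c₂ α₁ α₂ l₁ l₂ x t w)
          (Ioo 0 (l₂ - l₁))) ∧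
      HasContinuousDensityOnPos P (S t) (fun x => mtssDensityOfLT c₁ c₂ α₁ α₂ l₁ l₂ x t) ∧
      -- binomial expansions of the two powers, where they converge
      (∀ w : ℝ, 0 ≤ w → w < l₂ - l₁ →
        HasSum (fun k : ℕ => (l₂ - l₁) ^ α₁ *
          (Ring.choose α₁ k * (w ^ k / (l₁ - l₂) ^ k) * Real.cos (Real.pi * k)))
          ((l₂ - l₁ + w) ^ α₁) ∧
        HasSum (fun k : ℕ => (l₂ - l₁) ^ α₂ *
          (Ring.choose α₂ k * (w ^ k / (l₂ - l₁) ^ k) * Real.cos (Real.pi * k)))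
          ((l₂ - l₁ - w) ^ α₂))) ∧
    -- distinct tempering parameters, `l₂ < l₁`: the two components exchange their roles
    (l₂ < l₁ →
      (∀ x : ℝ, 0 < x →
        IntegrableOn (fun w => mtssOuterIntegrand c₂ c₁ α₂ α₁ l₂ l₁ x t w) (Ioi 0) ∧
        IntegrableOn (fun w => mtssInnerIntegrand c₂ c₁ α₂ α₁ l₂ l₁ x t w)
          (Ioo 0 (l₁ - l₂))) ∧
      HasContinuousDensityOnPos P (S t) (fun x => mtssDensityOfLT c₂ c₁ α₂ α₁ l₂ l₁ x t) ∧
      (∀ w : ℝ, 0 ≤ w → w < l₁ - l₂ →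
        HasSum (fun k : ℕ => (l₁ - l₂) ^ α₂ *
          (Ring.choose α₂ k * (w ^ k / (l₂ - l₁) ^ k) * Real.cos (Real.pi * k)))
          ((l₁ - l₂ + w) ^ α₂) ∧
        HasSum (fun k : ℕ => (l₁ - l₂) ^ α₁ *
          (Ring.choose α₁ k * (w ^ k / (l₁ - l₂) ^ k) * Real.cos (Real.pi * k)))
          ((l₁ - l₂ - w) ^ α₁))) ∧
    -- equal tempering parameters
    (l₁ = l₂ →
      (∀ x : ℝ, 0 < x →
        IntegrableOn (fun w => mtssEqIntegrand c₁ c₂ α₁ α₂ l₁ x t w) (Ioi 0)) ∧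
      HasContinuousDensityOnPos P (S t) (fun x => mtssDensityOfEq c₁ c₂ α₁ α₂ l₁ x t)) := by
  refine ⟨fun hlt => hS.representation_of_lt hc₁ hc₂ hc hα₁ hα₂ hl₁ hlt ht,
    fun hlt => hS.swap.representation_of_lt hc₂ hc₁ (by rwa [add_comm]) hα₂ hα₁ hl₂ hlt ht,
    fun heq => ?_⟩
  subst heq
  simp only [mtssEqIntegrand_eq_mtssOuterIntegrand, mtssDensityOfEq_eq_mtssDensityOfLT]
  exact ⟨fun x hx => integrableOn_mtssOuterIntegrand hc₁ hc₂ hα₁ hα₂ hl₁ le_rfl t.coe_nonneg hx,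
    hS.hasContinuousDensityOnPos hc₁ hc₂ hc hα₁ hα₂ hl₁ le_rfl ht⟩
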